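/- Let $(M,g)$ be a smooth four-dimensional Lorentzian manifold of signature $(-,+,+,+)$ with Levi-Civita connection $\nabla$ and Einstein tensor $G_{ab}$, and let $\phi:M\to\mathbb R$ be a smooth function with $\phi>0$ and timelike gradient, i.e. $X:=-\tfrac12\nabla_a\phi\nabla^a\phi>0$ everywhere. Let $\epsilon\in\{1,-1\}$ (in applications the sign for which $u$ is future-directed) and put $$u^a=\epsilon\,\frac{\nabla^a\phi}{\sqrt{2X}},\qquad \Theta=\nabla_au^a,\qquad \dot u^a=u^c\nabla_cu^a,\qquad h_{ab}=g_{ab}+u_au_b,\qquad \Box\phi=g^{ab}\nabla_a\nabla_b\phi .$$ For the viable Horndeski action $S^{(\mathrm g)}=\tfrac12\int d^4x\sqrt{-g}\,[G_4(\phi)R+G_2(\phi,X)-G_3(\phi,X)\Box\phi]$ let $\mathcal E_{ab}=\frac{2}{\sqrt{-g}}\frac{\delta S^{(\mathrm g)}}{\delta g^{ab}}$, explicitly $$\mathcal E_{ab}=G_4G_{ab}-\nabla_a\nabla_bG_4+g_{ab}\Box G_4-\tfrac12G_{2X}\nabla_a\phi\nabla_b\phi-\tfrac12G_2g_{ab}+\tfrac12G_{3X}\Box\phi\,\nabla_a\phi\nabla_b\phi+\nabla_{(a}G_3\nabla_{b)}\phi-\tfrac12g_{ab}\nabla_cG_3\nabla^c\phi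 .$$ For a positive coupling function $f(\phi,X)$ let the effective stress-energy tensor of the $\phi$-fluid be $T^{(f)}_{ab}=\frac1f\big(G_{ab}-\frac1{G_4}\mathcal E_{ab}\big)$, its heat flux density $q^{(f)}_a=-T^{(f)}_{cd}u^ch^d{}_a$, and define the temperature of gravity (multiplied by the thermal conductivity) as $$\mathcal K^{(f)}\mathcal T^{(f)}=\frac1f\,\frac{\epsilon\sqrt{2X}\,(G_{4\phi}-XG_{3X})}{G_4}.$$ Consider the "traditional" scalar-tensor theories $G_4=\phi$, $G_2=\frac{2\omega(\phi)}{\phi}X-V(\phi)$, $G_3=0$, with arbitrary functions $\omega,V$, and take $f=1/\phi$. Then, writing $\mathcal K\mathcal T$ for $\mathcal K^{(f)}\mathcal T^{(f)}$: 1. $\mathcal K\mathcal T=\epsilon\sqrt{2X}$, and it is the coefficient in the Eckart-type law $q^{(f)}_a=-\mathcal K\mathcal T\,\dot u_a$; 2. the temperature of gravity obeys the evolution equation $$\frac{d(\mathcal K\mathcal T)}{d\tau}=-\Theta\,\mathcal K\mathcal T+\Box\phi ,$$ where $\tau$ is the proper time of an observer comoving with the $\phi$-fluid; that is, $u^c\nabla_c(\mathcal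 K\mathcal T)=-\Theta\,\mathcal K\mathcal T+\Box\phi$ on $M$, and the equation holds along every integral curve $\gamma(\tau)$ of $u$. -/

import Mathlib

open scoped Manifold ContDiff
open Bundle

noncomputable section

namespace ScalarTensor

/-- The model space of a four-dimensional manifold. -/
abbrev E4 : Type := EuclideanSpace ℝ (Fin 4)

instance instNormedAddCommGroupBilin : NormedAddCommGroup (E4 →L[ℝ] E4 →L[ℝ] ℝ) :=
  ContinuousLinearMap.toNormedAddCommGroup

instance instNormedSpaceBilin : NormedSpace ℝ (E4 →L[ℝ] E4 →L[ℝ] ℝ) :=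
  ContinuousLinearMap.toNormedSpace

section Geometry

variable {M : Type*} [TopologicalSpace M] [ChartedSpace E4 M]

/-- Product rule for a bilinear form evaluated on two vectors. -/
lemma mvfderiv_clm_apply₂ {B : M → E4 →L[ℝ] E4 →L[ℝ] ℝ} {a b : M → E4} {p : M}
    (hB : MDifferentiableAt (𝓡 4) 𝓘(ℝ, E4 →L[ℝ] E4 →L[ℝ] ℝ) B p)
    (ha : MDifferentiableAt (𝓡 4) 𝓘(ℝ, E4) a p) (hb : MDifferentiableAt (𝓡 4) 𝓘(ℝ, E4) b p)
    (v : TangentSpace (𝓡 4) p) :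
    mvfderiv (𝓡 4) (fun q ↦ B q (a q) (b q)) p v =
      mvfderiv (𝓡 4) B p v (a p) (b p) + B p (mvfderiv (𝓡 4) a p v) (b p)
        + B p (a p) (mvfderiv (𝓡 4) b p v) := by
  have hB' : DifferentiableWithinAt ℝ (B ∘ (extChartAt (𝓡 4) p).symm) (Set.range (𝓡 4))
    (extChartAt (𝓡 4) p p) := hB.differentiableWithinAt_writtenInExtChartAt
  have ha' : DifferentiableWithinAt ℝ (a ∘ (extChartAt (𝓡 4) p).symm) (Set.range (𝓡 4))
    (extChartAt (𝓡 4) p p) := ha.differentiableWithinAt_writtenInExtChartAt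
  have hb' : DifferentiableWithinAt ℝ (b ∘ (extChartAt (𝓡 4) p).symm) (Set.range (𝓡 4))
    (extChartAt (𝓡 4) p p) := hb.differentiableWithinAt_writtenInExtChartAt
  have hc : MDifferentiableAt (𝓡 4) 𝓘(ℝ, ℝ) (fun q ↦ B q (a q) (b q)) p :=
    (hB.clm_apply ha).clm_apply hb
  have eB : mvfderiv (𝓡 4) B p = fderivWithin ℝ (B ∘ (extChartAt (𝓡 4) p).symm)
    (Set.range (𝓡 4)) (extChartAt (𝓡 4) p p) := hB.mvfderiv
  have ea : mvfderiv (𝓡 4) a p = fderivWithin ℝ (a ∘ (extChartAt (𝓡 4) p).symm)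
    (Set.range (𝓡 4)) (extChartAt (𝓡 4) p p) := ha.mvfderiv
  have eb : mvfderiv (𝓡 4) b p = fderivWithin ℝ (b ∘ (extChartAt (𝓡 4) p).symm)
    (Set.range (𝓡 4)) (extChartAt (𝓡 4) p p) := hb.mvfderiv
  have ec : mvfderiv (𝓡 4) (fun q ↦ B q (a q) (b q)) p =
    fderivWithin ℝ (fun y ↦ (B ∘ (extChartAt (𝓡 4) p).symm) y
      ((a ∘ (extChartAt (𝓡 4) p).symm) y) ((b ∘ (extChartAt (𝓡 4) p).symm) y))
      (Set.range (𝓡 4)) (extChartAt (𝓡 4) p p) := hc.mvfderiv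
  rw [eB, ea, eb, ec]
  rw [(𝓡 4).range_eq_univ] at *
  rw [differentiableWithinAt_univ] at hB' ha' hb'
  simp only [fderivWithin_univ]
  have h := (hB'.hasFDerivAt.clm_apply ha'.hasFDerivAt).clm_apply hb'.hasFDerivAt
  rw [h.fderiv]
  have hp : (extChartAt (𝓡 4) p).symm (extChartAt (𝓡 4) p p) = p := extChartAt_to_inv p
  simp only [Function.comp_apply, hp]
  have key : ∀ x y z : ℝ, x + (y + z) = z + y + x := by intros; ring
  exact key _ _ _

lemma isInvertible_of_nondegenerate (B : E4 →L[ℝ] E4 →L[ℝ] ℝ)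
    (h : ∀ a, (∀ b, B a b = 0) → a = 0) : B.IsInvertible := by
  have hinj : Function.Injective (B : E4 →ₗ[ℝ] E4 →L[ℝ] ℝ) := by
    rw [injective_iff_map_eq_zero]
    intro a ha
    exact h a fun b ↦ by
      have := congrArg (fun f : E4 →L[ℝ] ℝ ↦ f b) ha
      simpa using this
  have hrank : Module.finrank ℝ E4 = Module.finrank ℝ (E4 →L[ℝ] ℝ) := by
    rw [← (InnerProductSpace.toDual ℝ E4).toLinearEquiv.finrank_eq]
  refine ⟨((B : E4 →ₗ[ℝ] E4 →L[ℝ] ℝ).linearEquivOfInjective hinj hrank).toContinuousLinearEquiv, ?_⟩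
  ext a b
  rfl

variable [IsManifold (𝓡 4) ∞ M]

variable (M) in
/-- A smooth Lorentzian metric of signature `(-,+,+,+)` on a four-manifold. -/
structure LorentzMetric where
  /-- The bilinear form on each tangent space. -/
  val (p : M) : TangentSpace (𝓡 4) p →L[ℝ] TangentSpace (𝓡 4) p →L[ℝ] ℝ
  symm (p : M) (v w : TangentSpace (𝓡 4) p) : val p v w = val p w v
  /-- Each tangent space has an orthonormal basis with one timelike and three spacelike vectors. -/
  lorentzian (p : M) : ∃ b : Module.Basis (Fin 4) ℝ (TangentSpace (𝓡 4) p),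
    ∀ i j, val p (b i) (b j) = if i = j then (if i = 0 then -1 else 1) else 0
  contMDiff : ContMDiff (𝓡 4) ((𝓡 4).prod 𝓘(ℝ, E4 →L[ℝ] E4 →L[ℝ] ℝ)) ∞
    (fun p ↦ TotalSpace.mk' (E4 →L[ℝ] E4 →L[ℝ] ℝ) p (val p))

/-- A vector field is a section of the tangent bundle (no regularity is imposed here). -/
abbrev VField (M : Type*) [TopologicalSpace M] [ChartedSpace E4 M] : Type _ :=
  Π p : M, TangentSpace (𝓡 4) p

/-- The vector of `T_q M` with given components in the coordinate frame of the preferred chart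
at `p`. -/
def fromFrame (p q : M) : E4 →L[ℝ] TangentSpace (𝓡 4) q :=
  (trivializationAt E4 (TangentSpace (𝓡 4) : M → Type) p).symmL ℝ q

/-- The components of a vector of `T_q M` in the coordinate frame of the preferred chart at `p`. -/
def toFrame (p q : M) : TangentSpace (𝓡 4) q →L[ℝ] E4 :=
  (trivializationAt E4 (TangentSpace (𝓡 4) : M → Type) p).continuousLinearMapAt ℝ q

/-- The components at `q` of a vector field in the coordinate frame of the preferred chart
at `p`. -/
def vcomp (σ : VField M) (p q : M) : E4 := toFrame p q (σ q)

lemma mem_baseSet (p : M) :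
    p ∈ (trivializationAt E4 (TangentSpace (𝓡 4) : M → Type) p).baseSet :=
  FiberBundle.mem_baseSet_trivializationAt' p

lemma eventually_fromFrame_toFrame (p : M) :
    ∀ᶠ q in nhds p, ∀ v, fromFrame p q (toFrame p q v) = v := by
  filter_upwards [(trivializationAt E4 (TangentSpace (𝓡 4) : M → Type) p).open_baseSet.mem_nhds
    (mem_baseSet p)] with q hq v
  exact Trivialization.symmL_continuousLinearMapAt _ hq v

lemma fromFrame_toFrame (p : M) (v : TangentSpace (𝓡 4) p) :
    fromFrame p p (toFrame p p v) = v :=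
  (eventually_fromFrame_toFrame p).self_of_nhds v

lemma toFrame_fromFrame (p : M) (a : E4) : toFrame p p (fromFrame p p a) = a :=
  Trivialization.continuousLinearMapAt_symmL _ (mem_baseSet p) a

lemma mdifferentiableAt_iff_vcomp {σ : VField M} {p : M} :
    MDifferentiableAt (𝓡 4) ((𝓡 4).prod 𝓘(ℝ, E4))
      (fun q ↦ TotalSpace.mk' E4 q (σ q)) p ↔
      MDifferentiableAt (𝓡 4) 𝓘(ℝ, E4) (vcomp σ p) p := by
  rw [mdifferentiableAt_section]
  refine Filter.EventuallyEq.mdifferentiableAt_iff ?_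
  filter_upwards [(trivializationAt E4 (TangentSpace (𝓡 4) : M → Type) p).open_baseSet.mem_nhds
      (mem_baseSet p)] with q hq
  rw [vcomp, toFrame, Trivialization.continuousLinearMapAt_apply,
    Trivialization.linearMapAt_apply, if_pos hq]

namespace LorentzMetric

variable (g : LorentzMetric M)

/-- Index raising: `g.sharp p α` is the vector `v` with `g(v, ·) = α`. -/
def sharp (p : M) : (TangentSpace (𝓡 4) p →L[ℝ] ℝ) →L[ℝ] TangentSpace (𝓡 4) p :=
  (g.val p).inverse

lemma nondegenerate (p : M) (v : TangentSpace (𝓡 4) p) (h : ∀ w, g.val p v w = 0) : v = 0 := by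
  obtain ⟨b, hb⟩ := g.lorentzian p
  apply b.ext_elem
  intro j
  have h1 := h (b j)
  rw [← b.sum_repr v] at h1
  simp only [map_sum, map_smul, FunLike.coe_sum, Finset.sum_apply, smul_apply, hb,
    smul_eq_mul, mul_ite, mul_zero, Finset.sum_ite_eq', Finset.mem_univ, if_true] at h1
  rw [map_zero, Finsupp.zero_apply]
  split_ifs at h1 <;> simpa using h1

lemma isInvertible (p : M) : (g.val p).IsInvertible :=
  isInvertible_of_nondegenerate (g.val p) (g.nondegenerate p)

lemma sharp_val (p : M) (v : TangentSpace (𝓡 4) p) : g.sharp p (g.val p v) = v := by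
  obtain ⟨e, he⟩ := g.isInvertible p
  rw [sharp, ← he, ContinuousLinearMap.inverse_equiv]
  exact e.symm_apply_apply v

lemma val_sharp (p : M) (α : TangentSpace (𝓡 4) p →L[ℝ] ℝ) : g.val p (g.sharp p α) = α := by
  obtain ⟨e, he⟩ := g.isInvertible p
  rw [sharp, ← he, ContinuousLinearMap.inverse_equiv]
  exact e.apply_symm_apply α

/-- The gradient `∇^a ψ` of a function. -/
def grad (ψ : M → ℝ) : VField M := fun p ↦ g.sharp p (mvfderiv (𝓡 4) ψ p)

/-- The components `g_{ij}` of the metric at `q` in the coordinate frame of the preferred chart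
at `p`. -/
def gcomp (p q : M) : E4 →L[ℝ] E4 →L[ℝ] ℝ :=
  ((ContinuousLinearMap.precomp ℝ (fromFrame p q)) ∘L (g.val q)) ∘L (fromFrame p q)

@[simp] lemma gcomp_apply (p q : M) (a b : E4) :
    g.gcomp p q a b = g.val q (fromFrame p q a) (fromFrame p q b) := rfl

/-- The partial derivatives of the metric components at `p`: `g.dgcomp p c a b = ∂_c g_{ab}`. -/
def dgcomp (p : M) : E4 →L[ℝ] E4 →L[ℝ] E4 →L[ℝ] ℝ :=
  mvfderiv (𝓡 4) (g.gcomp p) p ∘L fromFrame p p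

/-- The Christoffel symbols at `p` in the preferred chart at `p`:
`g.christoffel p b a = Γ^c_{ab}` with
`Γ^c_{ab} = ½ g^{cd} (∂_a g_{bd} + ∂_b g_{ad} - ∂_d g_{ba})`. -/
def christoffel (p : M) (b : E4) : E4 →L[ℝ] E4 :=
  (g.gcomp p p).inverse ∘L
    ((1 / 2 : ℝ) • ((g.dgcomp p).flip b + g.dgcomp p b - ((g.dgcomp p).flip b).flip))

lemma christoffel_apply (p : M) (b a : E4) :
    g.christoffel p b a = (g.gcomp p p).inverse ((1 / 2 : ℝ) •
      (g.dgcomp p a b + g.dgcomp p b a - ((g.dgcomp p).flip b).flip a)) := rfl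

lemma christoffel_add (p : M) (b b' : E4) :
    g.christoffel p (b + b') = g.christoffel p b + g.christoffel p b' := by
  refine ContinuousLinearMap.ext fun a ↦ ?_
  rw [add_apply, christoffel_apply, christoffel_apply, christoffel_apply,
    ← map_add, ← smul_add]
  refine congrArg _ (congrArg _ (ContinuousLinearMap.ext fun c ↦ ?_))
  simp only [add_apply, sub_apply,
    ContinuousLinearMap.flip_apply, map_add]
  ring

lemma christoffel_smul (p : M) (r : ℝ) (b : E4) :
    g.christoffel p (r • b) = r • g.christoffel p b := by
  refine ContinuousLinearMap.ext fun a ↦ ?_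
  rw [smul_apply, christoffel_apply, christoffel_apply, ← map_smul,
    smul_comm r]
  refine congrArg _ (congrArg _ (ContinuousLinearMap.ext fun c ↦ ?_))
  simp only [add_apply, sub_apply,
    ContinuousLinearMap.flip_apply, map_smul, smul_apply, smul_eq_mul]
  ring

/-- The Levi-Civita connection `∇` of the metric: at `p`, in the preferred chart at `p`,
`(∇_v σ)^c = ∂_v σ^c + Γ^c_{ab} v^a σ^b`. The value of `∇_v σ` at `p` is
`g.leviCivita σ p v`. -/
def leviCivita : CovariantDerivative (𝓡 4) E4 (TangentSpace (𝓡 4) : M → Type) where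
  toFun σ p := fromFrame p p ∘L
    (mvfderiv (𝓡 4) (vcomp σ p) p + g.christoffel p (vcomp σ p p) ∘L toFrame p p)
  isCovariantDerivativeOnUniv := {
    add := by
      intro σ σ' p hσ hσ' _
      rw [mdifferentiableAt_iff_vcomp] at hσ hσ'
      have h : vcomp (σ + σ') p = vcomp σ p + vcomp σ' p := by
        ext1 q; simp [vcomp]
      rw [h, mvfderiv_add hσ hσ']
      ext1 v
      simp [vcomp, christoffel_add]
      abel
    leibniz := by
      intro σ f p hσ hf _
      rw [mdifferentiableAt_iff_vcomp] at hσ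
      have h : vcomp (f • σ) p = f • vcomp σ p := by
        ext1 q; simp [vcomp]
      rw [h, mvfderiv_smul hf hσ]
      ext1 v
      simp [vcomp, christoffel_smul, fromFrame_toFrame]
      abel }


lemma mdifferentiableAt_gcomp (p : M) :
    MDifferentiableAt (𝓡 4) 𝓘(ℝ, E4 →L[ℝ] E4 →L[ℝ] ℝ) (g.gcomp p) p := by
  have h := (contMDiffAt_hom_bundle _).1 (g.contMDiff p)
  refine MDifferentiableAt.congr_of_eventuallyEq (h.2.mdifferentiableAt (by simp)) ?_
  filter_upwards [(trivializationAt E4 (TangentSpace (𝓡 4) : M → Type) p).open_baseSet.mem_nhds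
    (mem_baseSet p)] with q hq
  ext a b
  have hq' : q ∈ (trivializationAt (E4 →L[ℝ] ℝ)
      (fun q : M ↦ TangentSpace (𝓡 4) q →L[ℝ] ℝ) p).baseSet := by
    rw [hom_trivializationAt_baseSet]
    exact ⟨hq, trivial⟩
  rw [ContinuousLinearMap.inCoordinates, ContinuousLinearMap.comp_apply,
    ContinuousLinearMap.comp_apply, Trivialization.continuousLinearMapAt_apply,
    Trivialization.linearMapAt_apply, if_pos hq', hom_trivializationAt_apply]
  simp [ContinuousLinearMap.inCoordinates, gcomp, fromFrame]

lemma gcomp_inverse (p : M) (α : E4 →L[ℝ] ℝ) : g.gcomp p p ((g.gcomp p p).inverse α) = α := by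
  have : (g.gcomp p p).IsInvertible := by
    refine isInvertible_of_nondegenerate _ fun a h ↦ ?_
    have h1 := g.nondegenerate p (fromFrame p p a) fun w ↦ by
      simpa [fromFrame_toFrame] using h (toFrame p p w)
    rw [← toFrame_fromFrame p a, h1, map_zero]
  obtain ⟨e, he⟩ := this
  rw [← he, ContinuousLinearMap.inverse_equiv]
  exact e.apply_symm_apply α

lemma dgcomp_symm (p : M) (c a b : E4) : g.dgcomp p c a b = g.dgcomp p c b a := by
  have hc (a : E4) : MDifferentiableAt (𝓡 4) 𝓘(ℝ, E4) (fun _ : M ↦ a) p := mdifferentiableAt_const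
  have h (a b : E4) := mvfderiv_clm_apply₂ (g.mdifferentiableAt_gcomp p) (hc a) (hc b)
    (fromFrame p p c)
  have h' (a b : E4) : g.dgcomp p c a b =
      mvfderiv (𝓡 4) (fun q ↦ g.gcomp p q a b) p (fromFrame p p c) := by
    rw [h a b]
    simp [dgcomp, mvfderiv_const]
  rw [h', h']
  congr 2
  ext q
  simp [g.symm q]

/-- The Christoffel symbols with lowered index. -/
lemma gcomp_christoffel (p : M) (b a c : E4) :
    g.gcomp p p (g.christoffel p b a) c =
      (1 / 2 : ℝ) * (g.dgcomp p a b c + g.dgcomp p b a c - g.dgcomp p c b a) := by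
  rw [christoffel_apply, gcomp_inverse]
  simp

/-- The connection is compatible with the metric. -/
theorem leviCivita_metric {σ τ : VField M} {p : M}
    (hσ : MDifferentiableAt (𝓡 4) ((𝓡 4).prod 𝓘(ℝ, E4)) (fun q ↦ TotalSpace.mk' E4 q (σ q)) p)
    (hτ : MDifferentiableAt (𝓡 4) ((𝓡 4).prod 𝓘(ℝ, E4)) (fun q ↦ TotalSpace.mk' E4 q (τ q)) p)
    (v : TangentSpace (𝓡 4) p) :
    mvfderiv (𝓡 4) (fun q ↦ g.val q (σ q) (τ q)) p v =
      g.val p (g.leviCivita σ p v) (τ p) + g.val p (σ p) (g.leviCivita τ p v) := by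
  have h : (fun q ↦ g.val q (σ q) (τ q)) =ᶠ[nhds p]
      fun q ↦ g.gcomp p q (vcomp σ p q) (vcomp τ p q) := by
    filter_upwards [eventually_fromFrame_toFrame p] with q hq
    simp [vcomp, hq]
  have h1 : mvfderiv (𝓡 4) (fun q ↦ g.val q (σ q) (τ q)) p =
      mvfderiv (𝓡 4) (fun q ↦ g.gcomp p q (vcomp σ p q) (vcomp τ p q)) p := by
    unfold mvfderiv
    rw [h.mfderiv_eq, h.self_of_nhds]
  have h2 (ξ : VField M) : g.leviCivita ξ p v = fromFrame p p
    (mvfderiv (𝓡 4) (vcomp ξ p) p v + g.christoffel p (vcomp ξ p p) (toFrame p p v)) := rfl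
  have h3 (ξ : VField M) : ξ p = fromFrame p p (vcomp ξ p p) := by
    rw [vcomp, fromFrame_toFrame]
  have h4 : mvfderiv (𝓡 4) (g.gcomp p) p v = g.dgcomp p (toFrame p p v) := by
    simp [dgcomp, fromFrame_toFrame]
  rw [h1, mvfderiv_clm_apply₂ (g.mdifferentiableAt_gcomp p) (mdifferentiableAt_iff_vcomp.1 hσ)
    (mdifferentiableAt_iff_vcomp.1 hτ), h2, h2, h3 σ, h3 τ, ← gcomp_apply, ← gcomp_apply, h4]
  have h5 (a b : E4) : g.gcomp p p a b = g.gcomp p p b a := by simp [g.symm p]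
  rw [map_add, map_add, add_apply, h5 _ (g.christoffel p _ _), gcomp_christoffel, gcomp_christoffel,
    g.dgcomp_symm p _ (vcomp τ p p), g.dgcomp_symm p (vcomp τ p p), g.dgcomp_symm p (vcomp σ p p)]
  ring

/-- The Lie bracket in the coordinates of the preferred chart. -/
lemma mlieBracket_eq {X Y : VField M} {p : M}
    (hX : MDifferentiableAt (𝓡 4) 𝓘(ℝ, E4) (vcomp X p) p)
    (hY : MDifferentiableAt (𝓡 4) 𝓘(ℝ, E4) (vcomp Y p) p) :
    VectorField.mlieBracket (𝓡 4) X Y p =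
      fromFrame p p (mvfderiv (𝓡 4) (vcomp Y p) p (X p) - mvfderiv (𝓡 4) (vcomp X p) p (Y p)) := by
  have key (X : VField M) : VectorField.mpullbackWithin 𝓘(ℝ, E4) (𝓡 4) (extChartAt (𝓡 4) p).symm X
      (Set.range (𝓡 4)) =ᶠ[nhds (extChartAt (𝓡 4) p p)]
      vcomp X p ∘ (extChartAt (𝓡 4) p).symm := by
    filter_upwards [extChartAt_target_mem_nhds p] with y hy
    have hy' := (extChartAt (𝓡 4) p).map_target hy
    rw [extChartAt_source] at hy'
    rw [VectorField.mpullbackWithin_apply, Function.comp_apply, vcomp, toFrame,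
      TangentBundle.continuousLinearMapAt_trivializationAt hy',
      ContinuousLinearMap.inverse_eq
        (mfderivWithin_extChartAt_symm_comp_mfderiv_extChartAt hy)
        (mfderiv_extChartAt_comp_mfderivWithin_extChartAt_symm hy)]
    rfl
  have hd (X : VField M) (hX : MDifferentiableAt (𝓡 4) 𝓘(ℝ, E4) (vcomp X p) p) :
      mvfderiv (𝓡 4) (vcomp X p) p =
      fderivWithin ℝ (vcomp X p ∘ (extChartAt (𝓡 4) p).symm)
        (Set.range (𝓡 4)) (extChartAt (𝓡 4) p p) := hX.mvfderiv
  have hp : p ∈ (chartAt E4 p).source := mem_chart_source E4 p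
  have hs : fromFrame p p =
      mfderivWithin 𝓘(ℝ, E4) (𝓡 4) (extChartAt (𝓡 4) p).symm (Set.range (𝓡 4))
        (extChartAt (𝓡 4) p p) := TangentBundle.symmL_trivializationAt hp
  have hX0 (X : VField M) : (vcomp X p ∘ (extChartAt (𝓡 4) p).symm) (extChartAt (𝓡 4) p p)
      = X p := by
    rw [Function.comp_apply, extChartAt_to_inv, vcomp, toFrame,
      TangentBundle.continuousLinearMapAt_trivializationAt_eq_core hp]
    exact (tangentBundleCore (𝓡 4) M).coordChange_self (achart E4 p) p hp (X p)
  have hi : (mfderiv (𝓡 4) 𝓘(ℝ, E4) (extChartAt (𝓡 4) p) p).inverse = fromFrame p p := by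
    have h := TangentBundle.continuousLinearMapAt_trivializationAt (I := 𝓡 4) hp
    change (mfderiv (𝓡 4) 𝓘(ℝ, E4) (extChartAt (𝓡 4) p) p :
      TangentSpace (𝓡 4) p →L[ℝ] E4).inverse = _
    rw [show (mfderiv (𝓡 4) 𝓘(ℝ, E4) (extChartAt (𝓡 4) p) p :
      TangentSpace (𝓡 4) p →L[ℝ] E4) = toFrame p p from h.symm]
    apply ContinuousLinearMap.inverse_eq
    · ext1 a
      exact toFrame_fromFrame p a
    · ext1 a
      exact fromFrame_toFrame p a
  rw [hd X hX, hd Y hY, VectorField.mlieBracket, VectorField.mlieBracketWithin_apply]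
  refine (congrArg (fun L : E4 →L[ℝ] TangentSpace (𝓡 4) p ↦ L _) hi).trans ?_
  refine congrArg (fromFrame p p) ?_
  have e (X Y : VField M) : fderivWithin ℝ
      (VectorField.mpullbackWithin 𝓘(ℝ, E4) (𝓡 4) (extChartAt (𝓡 4) p).symm Y (Set.range (𝓡 4)))
      (Set.range (𝓡 4)) (extChartAt (𝓡 4) p p)
      (VectorField.mpullbackWithin 𝓘(ℝ, E4) (𝓡 4) (extChartAt (𝓡 4) p).symm X (Set.range (𝓡 4))
        (extChartAt (𝓡 4) p p)) =
      fderivWithin ℝ (vcomp Y p ∘ (extChartAt (𝓡 4) p).symm)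
        (Set.range (𝓡 4)) (extChartAt (𝓡 4) p p) (X p) := by
    rw [← hX0 X]
    exact congrArg₂ (fun (L : E4 →L[ℝ] E4) (a : E4) ↦ L a) (key Y).fderivWithin_eq_of_nhds
      (key X).self_of_nhds
  rw [Set.preimage_univ, Set.univ_inter]
  exact congrArg₂ (· - ·) (e X Y) (e Y X)

/-- The connection is torsion free. -/
theorem leviCivita_torsion : g.leviCivita.torsion = 0 := by
  rw [CovariantDerivative.torsion_eq_zero_iff]
  intro X Y p hX hY
  rw [mdifferentiableAt_iff_vcomp] at hX hY
  rw [mlieBracket_eq hX hY]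
  have h2 (ξ : VField M) (v : TangentSpace (𝓡 4) p) : g.leviCivita ξ p v = fromFrame p p
    (mvfderiv (𝓡 4) (vcomp ξ p) p v + g.christoffel p (vcomp ξ p p) (toFrame p p v)) := rfl
  rw [h2, h2, ← map_sub]
  congr 1
  have h3 : g.christoffel p (vcomp Y p p) (toFrame p p (X p)) =
      g.christoffel p (vcomp X p p) (toFrame p p (Y p)) := by
    rw [christoffel_apply, christoffel_apply]
    congr 2
    ext c
    simp only [add_apply, sub_apply, ContinuousLinearMap.flip_apply, vcomp]
    rw [g.dgcomp_symm p c]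
    ring
  rw [h3]
  abel

/-! ### Second derivatives and curvature -/

/-- The Hessian `∇_a ∇_b ψ`, evaluated on two vectors. -/
def hess (ψ : M → ℝ) (p : M) (v w : TangentSpace (𝓡 4) p) : ℝ :=
  g.val p (g.leviCivita (g.grad ψ) p v) w

/-- The divergence `∇_a σ^a` of a vector field: the trace of `v ↦ ∇_v σ`. -/
def divergence (σ : VField M) (p : M) : ℝ :=
  LinearMap.trace ℝ (TangentSpace (𝓡 4) p) (g.leviCivita σ p).toLinearMap

/-- The d'Alembertian `□ψ = g^{ab} ∇_a ∇_b ψ`, i.e. the trace of `v ↦ ∇_v grad ψ`. -/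
def box (ψ : M → ℝ) (p : M) : ℝ := g.divergence (g.grad ψ) p

/-- The Riemann tensor `R(v, w) z = ∇_v ∇_w z - ∇_w ∇_v z`, where `v, w, z ∈ T_p M` are extended
near `p` with constant components in the preferred chart at `p` (such fields commute). -/
def riemann (p : M) (v w z : TangentSpace (𝓡 4) p) : TangentSpace (𝓡 4) p :=
  let Z : VField M := fun q ↦ fromFrame p q (toFrame p p z)
  g.leviCivita (fun q ↦ g.leviCivita Z q (fromFrame p q (toFrame p p w))) p v -
    g.leviCivita (fun q ↦ g.leviCivita Z q (fromFrame p q (toFrame p p v))) p w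

/-- The `i`-th coordinate vector of the preferred chart at `p`. -/
def coordVec (p : M) (i : Fin 4) : TangentSpace (𝓡 4) p :=
  fromFrame p p (EuclideanSpace.single i 1)

/-- The `i`-th coordinate covector of the preferred chart at `p`. -/
def coordCovec (p : M) (i : Fin 4) : TangentSpace (𝓡 4) p →L[ℝ] ℝ :=
  (EuclideanSpace.proj i : E4 →L[ℝ] ℝ) ∘L toFrame p p

/-- The Ricci tensor `R_{ab}`: the trace of `v ↦ R(v, w) z`. -/
def ricci (p : M) (w z : TangentSpace (𝓡 4) p) : ℝ :=
  ∑ i, coordCovec p i (g.riemann p (coordVec p i) w z)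

/-- The scalar curvature `R = g^{ab} R_{ab}`. -/
def scalarCurvature (p : M) : ℝ :=
  ∑ i, g.ricci p (coordVec p i) (g.sharp p (coordCovec p i))

/-- The Einstein tensor `G_{ab} = R_{ab} - ½ R g_{ab}`. -/
def einstein (p : M) (v w : TangentSpace (𝓡 4) p) : ℝ :=
  g.ricci p v w - 1 / 2 * g.scalarCurvature p * g.val p v w

/-! ### Kinematics of the scalar-field fluid -/

/-- `X = -½ ∇_a φ ∇^a φ`. The gradient of `φ` is timelike at `p` iff `0 < X`. -/
def kin (φ : M → ℝ) (p : M) : ℝ := -(1 / 2) * mvfderiv (𝓡 4) φ p (g.grad φ p)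

/-- The four-velocity `u^a = ε ∇^a φ / √(2X)` of the `φ`-fluid. -/
def velocity (ε : ℝ) (φ : M → ℝ) : VField M :=
  fun p ↦ (ε / √(2 * g.kin φ p)) • g.grad φ p

/-- The four-velocity is a unit timelike vector, so the parameter of its integral curves is proper
time. -/
lemma velocity_unit {ε : ℝ} (hε : ε = 1 ∨ ε = -1) {φ : M → ℝ} {p : M} (hX : 0 < g.kin φ p) :
    g.val p (g.velocity ε φ p) (g.velocity ε φ p) = -1 := by
  have h1 : g.val p (g.grad φ p) (g.grad φ p) = -(2 * g.kin φ p) := by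
    rw [grad, val_sharp, kin, grad]
    ring
  have h2 : √(2 * g.kin φ p) ^ 2 = 2 * g.kin φ p := Real.sq_sqrt (by positivity)
  have h3 : √(2 * g.kin φ p) ≠ 0 := (Real.sqrt_pos.2 (by positivity)).ne'
  have h4 : ε ^ 2 = 1 := by rcases hε with rfl | rfl <;> norm_num
  simp only [velocity, map_smul, smul_apply, smul_eq_mul, h1]
  field_simp
  rw [h2, h4]
  field_simp

/-- The expansion scalar `Θ = ∇_a u^a`. -/
def expansion (ε : ℝ) (φ : M → ℝ) (p : M) : ℝ := g.divergence (g.velocity ε φ) p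

/-- The four-acceleration `u^c ∇_c u^a`. -/
def acceleration (ε : ℝ) (φ : M → ℝ) : VField M :=
  fun p ↦ g.leviCivita (g.velocity ε φ) p (g.velocity ε φ p)

end LorentzMetric

/-! ### Viable Horndeski gravity -/

/-- The free functions of viable Horndeski gravity, with action
`½ ∫ d⁴x √(-g) [G₄(φ) R + G₂(φ, X) - G₃(φ, X) □φ]`. -/
structure ViableHorndeski where
  /-- The function `G₂(φ, X)`. -/
  G2 : ℝ → ℝ → ℝ
  /-- The function `G₃(φ, X)`. -/
  G3 : ℝ → ℝ → ℝ
  /-- The function `G₄(φ)`. -/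
  G4 : ℝ → ℝ

namespace ViableHorndeski

/-- "Traditional" scalar-tensor theories:
`G₄ = φ`, `G₂ = 2 Ω(φ) X / φ - V(φ)`, `G₃ = 0` (the function usually called lower-case omega is
written `Omega` here). -/
def traditional (Omega V : ℝ → ℝ) : ViableHorndeski where
  G2 := fun s x ↦ 2 * Omega s / s * x - V s
  G3 := fun _ _ ↦ 0
  G4 := fun s ↦ s

variable (S : ViableHorndeski) (g : LorentzMetric M) (φ : M → ℝ)

/-- The tensor `𝓔_{ab} = (2 / √(-g)) δS / δg^{ab}` of the metric field equations `𝓔_{ab} = T_{ab}`,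
i.e. the Euler-Lagrange expression of the action with respect to the inverse metric:
`G₄ G_{ab} - ∇_a ∇_b G₄ + g_{ab} □G₄ - ½ G_{2X} ∇_a φ ∇_b φ - ½ G₂ g_{ab}
  + ½ G_{3X} □φ ∇_a φ ∇_b φ + ∇_{(a} G₃ ∇_{b)} φ - ½ g_{ab} ∇_c G₃ ∇^c φ`. -/
def fieldTensor (p : M) (v w : TangentSpace (𝓡 4) p) : ℝ :=
  let X := g.kin φ
  let G4φ : M → ℝ := fun q ↦ S.G4 (φ q)
  let G3φ : M → ℝ := fun q ↦ S.G3 (φ q) (X q)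
  let dφ := mvfderiv (𝓡 4) φ p
  let dG3 := mvfderiv (𝓡 4) G3φ p
  S.G4 (φ p) * g.einstein p v w - g.hess G4φ p v w + g.val p v w * g.box G4φ p
    - 1 / 2 * deriv (S.G2 (φ p)) (X p) * dφ v * dφ w - 1 / 2 * S.G2 (φ p) (X p) * g.val p v w
    + 1 / 2 * deriv (S.G3 (φ p)) (X p) * g.box φ p * dφ v * dφ w
    + 1 / 2 * (dG3 v * dφ w + dG3 w * dφ v) - 1 / 2 * g.val p v w * dG3 (g.grad φ p)

/-- The effective stress-energy tensor of the `φ`-fluid,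
`T^{(f)}_{ab} = (1/f) (G_{ab} - 𝓔_{ab} / G₄)`. -/
def effectiveStress (f : ℝ → ℝ → ℝ) (p : M) (v w : TangentSpace (𝓡 4) p) : ℝ :=
  1 / f (φ p) (g.kin φ p) * (g.einstein p v w - 1 / S.G4 (φ p) * S.fieldTensor g φ p v w)

/-- The heat flux density `q_a = -T^{(f)}_{cd} u^c h^d_a` of the `φ`-fluid, evaluated on a vector
`w^a`, with `h^d_a w^a = w^d + u^d u_a w^a`. -/
def heatFlux (f : ℝ → ℝ → ℝ) (ε : ℝ) (p : M) (w : TangentSpace (𝓡 4) p) : ℝ :=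
  let u := g.velocity ε φ p;
  -S.effectiveStress g φ f p u (w + g.val p u w • u)

/-- The temperature of gravity (times the thermal conductivity) of the `φ`-fluid,
`𝒦^{(f)} 𝒯^{(f)} = f⁻¹ ε √(2X) (G_{4φ} - X G_{3X}) / G₄`. -/
def gravTemp (f : ℝ → ℝ → ℝ) (ε : ℝ) (p : M) : ℝ :=
  let X := g.kin φ p;
  (f (φ p) X)⁻¹ * (ε * √(2 * X) * (deriv S.G4 (φ p) - X * deriv (S.G3 (φ p)) X) / S.G4 (φ p))

end ViableHorndeski

end Geometry

end ScalarTensor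

end

/-! Put `κ = ε √(2X)`, so that `∇φ = κ u` and, by the Leibniz rule,
`∇_a ∇^b φ = κ ∇_a u^b + u^b ∂_a κ`. The trace of this identity is `□φ = κ Θ + u(κ)`, the
evolution equation of `κ`. Contracting it with `u` and some `w ⟂ u` gives
`∇_a ∇_b φ u^a w^b = κ u̇_b w^b`, and then the symmetry of the Hessian gives
`w(X) = -2X u̇_b w^b`. In `u^a w^b 𝓔_{ab}` only the terms in `G_{ab}`, `∇_a ∇_b G₄` and
`∇_{(a} G₃ ∇_{b)} φ` survive, and the last two add up to `-κ (G_{4φ} - X G_{3X}) u̇_b w^b`: this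
is the Eckart law in every viable Horndeski theory. The coupling `f = (G_{4φ} - X G_{3X}) / G₄`,
which is `1 / φ` in the traditional theories, makes the temperature equal to `κ`.
-/

namespace ScalarTensor

open scoped Topology

section Calculus

variable {E H M F G : Type*} [NormedAddCommGroup E] [NormedSpace ℝ E] [TopologicalSpace H]
  {I : ModelWithCorners ℝ E H} [TopologicalSpace M] [ChartedSpace H M]
  [NormedAddCommGroup F] [NormedSpace ℝ F] [NormedAddCommGroup G] [NormedSpace ℝ G] {p : M}

lemma mvfderiv_congr {f f' : M → F} (h : f =ᶠ[𝓝 p] f') : mvfderiv I f p = mvfderiv I f' p := by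
  unfold mvfderiv
  rw [h.mfderiv_eq, h.self_of_nhds]

lemma mvfderiv_comp_apply_of_hasFDerivAt {h : F → G} {L : F →L[ℝ] G} {f : M → F}
    (hh : HasFDerivAt h L (f p)) (hf : MDifferentiableAt I 𝓘(ℝ, F) f p) (v : TangentSpace I p) :
    mvfderiv I (fun q ↦ h (f q)) p v = L (mvfderiv I f p v) :=
  congrArg (fun L : TangentSpace I p →L[ℝ] G ↦ L v)
    (hh.hasMFDerivAt.comp p hf.hasMFDerivAt).mfderiv

lemma mvfderiv_comp_eq_deriv_smul {h : ℝ → ℝ} {f : M → ℝ}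
    (hh : DifferentiableAt ℝ h (f p)) (hf : MDifferentiableAt I 𝓘(ℝ, ℝ) f p) :
    mvfderiv I (fun q ↦ h (f q)) p = deriv h (f p) • mvfderiv I f p := by
  ext v
  rw [mvfderiv_comp_apply_of_hasFDerivAt hh.hasFDerivAt hf]
  simp [mul_comm]

lemma mvfderiv_comp₂_eq_deriv_smul_add {h : ℝ → ℝ → ℝ} {f f' : M → ℝ}
    (hh : DifferentiableAt ℝ (fun z : ℝ × ℝ ↦ h z.1 z.2) (f p, f' p))
    (hf : MDifferentiableAt I 𝓘(ℝ, ℝ) f p) (hf' : MDifferentiableAt I 𝓘(ℝ, ℝ) f' p) :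
    mvfderiv I (fun q ↦ h (f q) (f' q)) p =
      deriv (fun s ↦ h s (f' p)) (f p) • mvfderiv I f p +
        deriv (h (f p)) (f' p) • mvfderiv I f' p := by
  have hpair : MDifferentiableAt I 𝓘(ℝ, ℝ × ℝ) (fun q ↦ (f q, f' q)) p := hf.prodMk_space hf'
  have hfst := hh.hasFDerivAt.comp_hasDerivAt (f p)
    ((hasDerivAt_id (f p)).prodMk (hasDerivAt_const (f p) (f' p)))
  have hsnd := hh.hasFDerivAt.comp_hasDerivAt (f' p)
    ((hasDerivAt_const (f' p) (f p)).prodMk (hasDerivAt_id (f' p)))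
  set L := fderiv ℝ (fun z : ℝ × ℝ ↦ h z.1 z.2) (f p, f' p)
  ext v
  have hsplit (x y : ℝ) : L (x, y) = x * L (1, 0) + y * L (0, 1) := by
    rw [← smul_eq_mul, ← smul_eq_mul, ← map_smul, ← map_smul, ← map_add]
    simp
  have hfst_pair := mvfderiv_comp_apply_of_hasFDerivAt hasFDerivAt_fst hpair v
  have hsnd_pair := mvfderiv_comp_apply_of_hasFDerivAt hasFDerivAt_snd hpair v
  calc mvfderiv I (fun q ↦ h (f q) (f' q)) p v
      = L (mvfderiv I (fun q ↦ (f q, f' q)) p v) :=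
        mvfderiv_comp_apply_of_hasFDerivAt (f := fun q ↦ (f q, f' q)) hh.hasFDerivAt hpair v
    _ = L (mvfderiv I f p v, mvfderiv I f' p v) :=
        congrArg L (Prod.ext hfst_pair.symm hsnd_pair.symm)
    _ = mvfderiv I f p v * L (1, 0) + mvfderiv I f' p v * L (0, 1) := hsplit _ _
    _ = deriv (fun s ↦ h s (f' p)) (f p) * mvfderiv I f p v +
        deriv (h (f p)) (f' p) * mvfderiv I f' p v := by
      rw [← hfst.deriv, ← hsnd.deriv, mul_comm, mul_comm (mvfderiv I f' p v)]
      rfl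

lemma mdifferentiableAt_inverse_clm_apply [CompleteSpace F] {A : M → F →L[ℝ] G} {b : M → G}
    (hA : MDifferentiableAt I 𝓘(ℝ, F →L[ℝ] G) A p) (hb : MDifferentiableAt I 𝓘(ℝ, G) b p)
    (hi : (A p).IsInvertible) :
    MDifferentiableAt I 𝓘(ℝ, F) (fun q ↦ (A q).inverse (b q)) p := by
  have hinv : ContDiffAt ℝ 1 ContinuousLinearMap.inverse (A p) := hi.contDiffAt_map_inverse
  exact ((hinv.differentiableAt one_ne_zero).mdifferentiableAt.comp p hA).clm_apply hb

lemma hasDerivAt_comp_of_isMIntegralCurveAt {f : M → ℝ} {v : Π q : M, TangentSpace I q}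
    {γ : ℝ → M} {t : ℝ} (hf : MDifferentiableAt I 𝓘(ℝ, ℝ) f (γ t))
    (hγ : IsMIntegralCurveAt γ v t) :
    HasDerivAt (fun s ↦ f (γ s)) (mvfderiv I f (γ t) (v (γ t))) t := by
  have hcomp : HasFDerivAt (f ∘ γ)
      ((mvfderiv I f (γ t)).comp ((1 : ℝ →L[ℝ] ℝ).smulRight (v (γ t)))) t :=
    (hf.hasMFDerivAt.comp t hγ.self_of_nhds).hasFDerivAt
  have hderiv := hcomp.hasDerivAt
  rw [ContinuousLinearMap.comp_apply, ContinuousLinearMap.smulRight_apply,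
    one_apply_eq_self, one_smul] at hderiv
  exact hderiv

end Calculus

section Frame

variable {M : Type*} [TopologicalSpace M] [ChartedSpace E4 M] {ψ : M → ℝ} {p : M}

lemma contDiffAt_comp_extChartAt_symm (hψ : ContMDiffAt (𝓡 4) 𝓘(ℝ, ℝ) 2 ψ p) :
    ContDiffAt ℝ 2 (ψ ∘ (extChartAt (𝓡 4) p).symm) (extChartAt (𝓡 4) p p) := by
  have h := (contMDiffAt_iff.1 hψ).2
  rwa [(𝓡 4).range_eq_univ, contDiffWithinAt_univ] at h

lemma differentiableAt_fderiv_comp_extChartAt_symm (hψ : ContMDiffAt (𝓡 4) 𝓘(ℝ, ℝ) 2 ψ p) :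
    DifferentiableAt ℝ (fderiv ℝ (ψ ∘ (extChartAt (𝓡 4) p).symm)) (extChartAt (𝓡 4) p p) :=
  ((contDiffAt_comp_extChartAt_symm hψ).fderiv_right (m := 1) le_rfl).differentiableAt one_ne_zero

variable [IsManifold (𝓡 4) ∞ M]

/-- The partial derivatives `∂_i ψ` at `q`, with respect to the coordinates of the preferred chart
at `p`. -/
noncomputable def partialDeriv (ψ : M → ℝ) (p q : M) : E4 →L[ℝ] ℝ :=
  mvfderiv (𝓡 4) ψ q ∘L fromFrame p q

lemma eventually_toFrame_fromFrame (p : M) :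
    ∀ᶠ q in 𝓝 p, ∀ a, toFrame p q (fromFrame p q a) = a := by
  filter_upwards [(trivializationAt E4 (TangentSpace (𝓡 4) : M → Type) p).open_baseSet.mem_nhds
    (mem_baseSet p)] with q hq a
  exact Trivialization.continuousLinearMapAt_symmL _ hq a

lemma mvfderiv_extChartAt {q : M} (hq : q ∈ (chartAt E4 p).source) :
    mvfderiv (𝓡 4) (extChartAt (𝓡 4) p) q = toFrame p q :=
  (TangentBundle.continuousLinearMapAt_trivializationAt hq).symm

lemma eventually_partialDeriv_eq_fderiv (hψ : ContMDiffAt (𝓡 4) 𝓘(ℝ, ℝ) 2 ψ p) :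
    ∀ᶠ q in 𝓝 p, partialDeriv ψ p q =
      fderiv ℝ (ψ ∘ (extChartAt (𝓡 4) p).symm) (extChartAt (𝓡 4) p q) := by
  have hdiff : ∀ᶠ q in 𝓝 p, DifferentiableAt ℝ (ψ ∘ (extChartAt (𝓡 4) p).symm)
      (extChartAt (𝓡 4) p q) := by
    refine (continuousAt_extChartAt (I := 𝓡 4) p).eventually ?_
    filter_upwards [(contDiffAt_comp_extChartAt_symm hψ).eventually (by simp)] with y hy
    exact hy.differentiableAt two_ne_zero
  filter_upwards [hdiff, eventually_toFrame_fromFrame p, chart_source_mem_nhds E4 p]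
    with q hq hframe hsource
  have hchart : (fun x ↦ (ψ ∘ (extChartAt (𝓡 4) p).symm) (extChartAt (𝓡 4) p x)) =ᶠ[𝓝 q] ψ := by
    filter_upwards [(isOpen_extChartAt_source (I := 𝓡 4) p).mem_nhds
      (by rwa [extChartAt_source])] with x hx
    exact congrArg ψ ((extChartAt (𝓡 4) p).left_inv hx)
  ext a
  rw [partialDeriv, ContinuousLinearMap.comp_apply, ← mvfderiv_congr hchart,
    mvfderiv_comp_apply_of_hasFDerivAt hq.hasFDerivAt (mdifferentiableAt_extChartAt hsource),
    mvfderiv_extChartAt hsource, hframe]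

lemma mdifferentiableAt_partialDeriv (hψ : ContMDiffAt (𝓡 4) 𝓘(ℝ, ℝ) 2 ψ p) :
    MDifferentiableAt (𝓡 4) 𝓘(ℝ, E4 →L[ℝ] ℝ) (partialDeriv ψ p) p :=
  ((differentiableAt_fderiv_comp_extChartAt_symm hψ).mdifferentiableAt.comp p
    (mdifferentiableAt_extChartAt (mem_chart_source E4 p))).congr_of_eventuallyEq
    (eventually_partialDeriv_eq_fderiv hψ)

lemma mvfderiv_partialDeriv_symm (hψ : ContMDiffAt (𝓡 4) 𝓘(ℝ, ℝ) 2 ψ p) (a b : E4) :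
    mvfderiv (𝓡 4) (partialDeriv ψ p) p (fromFrame p p a) b =
      mvfderiv (𝓡 4) (partialDeriv ψ p) p (fromFrame p p b) a := by
  have hchart (a : E4) : mvfderiv (𝓡 4) (partialDeriv ψ p) p (fromFrame p p a) =
      fderiv ℝ (fderiv ℝ (ψ ∘ (extChartAt (𝓡 4) p).symm)) (extChartAt (𝓡 4) p p) a := by
    rw [mvfderiv_congr (eventually_partialDeriv_eq_fderiv hψ), mvfderiv_comp_apply_of_hasFDerivAt
      (differentiableAt_fderiv_comp_extChartAt_symm hψ).hasFDerivAt
      (mdifferentiableAt_extChartAt (mem_chart_source E4 p)),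
      mvfderiv_extChartAt (mem_chart_source E4 p), toFrame_fromFrame]
  rw [hchart, hchart]
  exact (contDiffAt_comp_extChartAt_symm hψ).isSymmSndFDerivAt (by simp) a b

end Frame

variable {M : Type*} [TopologicalSpace M] [ChartedSpace E4 M] [IsManifold (𝓡 4) ∞ M]

namespace LorentzMetric

variable (g : LorentzMetric M) {ψ : M → ℝ} {p : M}

section Gradient

lemma eventually_isInvertible_gcomp (p : M) : ∀ᶠ q in 𝓝 p, (g.gcomp p q).IsInvertible := by
  filter_upwards [eventually_fromFrame_toFrame p, eventually_toFrame_fromFrame p] with q hq hq'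
  refine isInvertible_of_nondegenerate _ fun a h ↦ ?_
  have hzero := g.nondegenerate q (fromFrame p q a) fun w ↦ by
    simpa [hq] using h (toFrame p q w)
  rw [← hq' a, hzero, map_zero]

lemma mdifferentiableAt_val {σ τ : VField M}
    (hσ : MDifferentiableAt (𝓡 4) ((𝓡 4).prod 𝓘(ℝ, E4)) (fun q ↦ TotalSpace.mk' E4 q (σ q)) p)
    (hτ : MDifferentiableAt (𝓡 4) ((𝓡 4).prod 𝓘(ℝ, E4)) (fun q ↦ TotalSpace.mk' E4 q (τ q)) p) :
    MDifferentiableAt (𝓡 4) 𝓘(ℝ, ℝ) (fun q ↦ g.val q (σ q) (τ q)) p := by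
  rw [mdifferentiableAt_iff_vcomp] at hσ hτ
  refine (((g.mdifferentiableAt_gcomp p).clm_apply hσ).clm_apply hτ).congr_of_eventuallyEq ?_
  filter_upwards [eventually_fromFrame_toFrame p] with q hq
  simp [vcomp, hq]

lemma val_grad (ψ : M → ℝ) (p : M) (v : TangentSpace (𝓡 4) p) :
    g.val p (g.grad ψ p) v = mvfderiv (𝓡 4) ψ p v := by
  rw [grad, val_sharp]

lemma eventually_vcomp_grad (ψ : M → ℝ) (p : M) :
    ∀ᶠ q in 𝓝 p, vcomp (g.grad ψ) p q = (g.gcomp p q).inverse (partialDeriv ψ p q) := by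
  filter_upwards [eventually_fromFrame_toFrame p, g.eventually_isInvertible_gcomp p] with q hq hi
  have hlower : partialDeriv ψ p q = g.gcomp p q (vcomp (g.grad ψ) p q) := by
    ext a
    simp [partialDeriv, vcomp, hq, val_grad]
  rw [hlower, hi.inverse_apply_self]

lemma mdifferentiableAt_grad (hψ : ContMDiffAt (𝓡 4) 𝓘(ℝ, ℝ) 2 ψ p) :
    MDifferentiableAt (𝓡 4) ((𝓡 4).prod 𝓘(ℝ, E4))
      (fun q ↦ TotalSpace.mk' E4 q (g.grad ψ q)) p := by
  rw [mdifferentiableAt_iff_vcomp]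
  exact (mdifferentiableAt_inverse_clm_apply (g.mdifferentiableAt_gcomp p)
    (mdifferentiableAt_partialDeriv hψ)
    (g.eventually_isInvertible_gcomp p).self_of_nhds).congr_of_eventuallyEq
    (g.eventually_vcomp_grad ψ p)

lemma kin_eq_val_grad (ψ : M → ℝ) (q : M) :
    g.kin ψ q = -(1 / 2) * g.val q (g.grad ψ q) (g.grad ψ q) := by
  rw [kin, val_grad]

lemma mdifferentiableAt_kin (hψ : ContMDiffAt (𝓡 4) 𝓘(ℝ, ℝ) 2 ψ p) :
    MDifferentiableAt (𝓡 4) 𝓘(ℝ, ℝ) (g.kin ψ) p := by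
  simp only [funext (g.kin_eq_val_grad ψ)]
  exact (g.mdifferentiableAt_val (g.mdifferentiableAt_grad hψ)
    (g.mdifferentiableAt_grad hψ)).const_smul (-(1 / 2) : ℝ)

end Gradient

section Hessian

lemma mvfderiv_kin (hψ : ContMDiffAt (𝓡 4) 𝓘(ℝ, ℝ) 2 ψ p) (v : TangentSpace (𝓡 4) p) :
    mvfderiv (𝓡 4) (g.kin ψ) p v = -g.hess ψ p v (g.grad ψ p) := by
  have hgrad := g.mdifferentiableAt_grad hψ
  rw [funext (g.kin_eq_val_grad ψ),
    mvfderiv_comp_eq_deriv_smul (h := (-(1 / 2) * ·)) (by fun_prop)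
      (g.mdifferentiableAt_val hgrad hgrad),
    smul_apply, g.leviCivita_metric hgrad hgrad, hess, g.symm p _ (g.leviCivita _ _ _),
    deriv_const_mul_field, deriv_id'', smul_eq_mul]
  ring

lemma eventually_vcomp_fromFrame (p : M) (a : E4) :
    vcomp (fun q ↦ fromFrame p q a) p =ᶠ[𝓝 p] fun _ ↦ a := by
  filter_upwards [eventually_toFrame_fromFrame p] with q hq
  exact hq a

lemma mdifferentiableAt_fromFrame (p : M) (a : E4) :
    MDifferentiableAt (𝓡 4) ((𝓡 4).prod 𝓘(ℝ, E4))
      (fun q ↦ TotalSpace.mk' E4 q (fromFrame p q a)) p := by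
  rw [mdifferentiableAt_iff_vcomp]
  exact mdifferentiableAt_const.congr_of_eventuallyEq (eventually_vcomp_fromFrame p a)

lemma leviCivita_fromFrame_symm (p : M) (a b : E4) :
    g.leviCivita (fun q ↦ fromFrame p q b) p (fromFrame p p a) =
      g.leviCivita (fun q ↦ fromFrame p q a) p (fromFrame p p b) := by
  have hvcomp (a : E4) := mdifferentiableAt_iff_vcomp.1 (mdifferentiableAt_fromFrame p a)
  have hbracket : VectorField.mlieBracket (𝓡 4) (fun q ↦ fromFrame p q a)
      (fun q ↦ fromFrame p q b) p = 0 := by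
    rw [mlieBracket_eq (hvcomp a) (hvcomp b), mvfderiv_congr (eventually_vcomp_fromFrame p a),
      mvfderiv_congr (eventually_vcomp_fromFrame p b), mvfderiv_const, mvfderiv_const]
    simp
  have htorsion := (CovariantDerivative.torsion_eq_zero_iff _).1 g.leviCivita_torsion
    (mdifferentiableAt_fromFrame p a) (mdifferentiableAt_fromFrame p b)
  rwa [hbracket, sub_eq_zero] at htorsion

lemma hess_fromFrame (hψ : ContMDiffAt (𝓡 4) 𝓘(ℝ, ℝ) 2 ψ p) (v : TangentSpace (𝓡 4) p) (b : E4) :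
    g.hess ψ p v (fromFrame p p b) = mvfderiv (𝓡 4) (partialDeriv ψ p) p v b -
      mvfderiv (𝓡 4) ψ p (g.leviCivita (fun q ↦ fromFrame p q b) p v) := by
  have hmetric := g.leviCivita_metric (g.mdifferentiableAt_grad hψ)
    (mdifferentiableAt_fromFrame p b) v
  have hpartial : mvfderiv (𝓡 4) (fun q ↦ partialDeriv ψ p q b) p v =
      mvfderiv (𝓡 4) (partialDeriv ψ p) p v b :=
    mvfderiv_comp_apply_of_hasFDerivAt (ContinuousLinearMap.apply ℝ ℝ b).hasFDerivAt
      (mdifferentiableAt_partialDeriv hψ) v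
  simp only [val_grad] at hmetric
  rw [hess, ← hpartial, eq_sub_iff_add_eq]
  exact hmetric.symm

lemma hess_symm (hψ : ContMDiffAt (𝓡 4) 𝓘(ℝ, ℝ) 2 ψ p) (v w : TangentSpace (𝓡 4) p) :
    g.hess ψ p v w = g.hess ψ p w v := by
  rw [← fromFrame_toFrame p v, ← fromFrame_toFrame p w, g.hess_fromFrame hψ, g.hess_fromFrame hψ,
    mvfderiv_partialDeriv_symm hψ, g.leviCivita_fromFrame_symm]

lemma leviCivita_congr {σ τ : VField M} (h : ∀ᶠ q in 𝓝 p, σ q = τ q) :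
    g.leviCivita σ p = g.leviCivita τ p := by
  have hvcomp : vcomp σ p =ᶠ[𝓝 p] vcomp τ p := h.mono fun q hq ↦ congrArg (toFrame p q) hq
  change fromFrame p p ∘L (mvfderiv (𝓡 4) (vcomp σ p) p + g.christoffel p (vcomp σ p p) ∘L _) =
    fromFrame p p ∘L (mvfderiv (𝓡 4) (vcomp τ p) p + g.christoffel p (vcomp τ p p) ∘L _)
  rw [mvfderiv_congr hvcomp, hvcomp.self_of_nhds]

lemma leviCivita_smul_of_eventuallyEq {σ τ : VField M} {f : M → ℝ}
    (h : ∀ᶠ q in 𝓝 p, σ q = f q • τ q) (hf : MDifferentiableAt (𝓡 4) 𝓘(ℝ, ℝ) f p)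
    (hτ : MDifferentiableAt (𝓡 4) ((𝓡 4).prod 𝓘(ℝ, E4)) (fun q ↦ TotalSpace.mk' E4 q (τ q)) p) :
    g.leviCivita σ p =
      f p • g.leviCivita τ p + (mvfderiv (𝓡 4) f p).smulRight (τ p) := by
  rw [← g.leviCivita.isCovariantDerivativeOnUniv.leibniz hτ hf]
  exact g.leviCivita_congr h

lemma hess_comp {h : ℝ → ℝ} (hh : ContDiffAt ℝ 2 h (ψ p))
    (hψ : ContMDiffAt (𝓡 4) 𝓘(ℝ, ℝ) 2 ψ p) (v w : TangentSpace (𝓡 4) p) :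
    g.hess (fun q ↦ h (ψ q)) p v w = deriv h (ψ p) * g.hess ψ p v w +
      deriv (deriv h) (ψ p) * mvfderiv (𝓡 4) ψ p v * mvfderiv (𝓡 4) ψ p w := by
  have hψ_mdiff := hψ.mdifferentiableAt two_ne_zero
  have hderiv : DifferentiableAt ℝ (deriv h) (ψ p) :=
    (hh.derivWithin (m := 1) le_rfl).differentiableAt one_ne_zero
  have hgrad : ∀ᶠ q in 𝓝 p, g.grad (fun q ↦ h (ψ q)) q = deriv h (ψ q) • g.grad ψ q := by
    filter_upwards [hψ.continuousAt.eventually (hh.eventually (by simp)),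
      (contMDiffAt_iff_contMDiffAt_nhds (by simp)).1 hψ] with q hh hψ
    rw [grad, grad, mvfderiv_comp_eq_deriv_smul (hh.differentiableAt two_ne_zero)
      (hψ.mdifferentiableAt two_ne_zero), map_smul]
  rw [hess, g.leviCivita_smul_of_eventuallyEq hgrad
    (hderiv.mdifferentiableAt.comp p hψ_mdiff) (g.mdifferentiableAt_grad hψ)]
  rw [mvfderiv_comp_eq_deriv_smul hderiv hψ_mdiff]
  simp [val_grad, hess]

end Hessian

section Velocity

variable {ε : ℝ} {φ : M → ℝ}

/-- The signed gradient speed `κ = ε √(2X)`, for which `∇^a φ = κ u^a`. -/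
noncomputable def gradSpeed (ε : ℝ) (φ : M → ℝ) (p : M) : ℝ := ε * √(2 * g.kin φ p)

lemma gradSpeed_sq (hε : ε = 1 ∨ ε = -1) (hX : 0 < g.kin φ p) :
    g.gradSpeed ε φ p ^ 2 = 2 * g.kin φ p := by
  rw [gradSpeed, mul_pow, Real.sq_sqrt (by positivity), sq_eq_one_iff.2 hε, one_mul]

lemma mdifferentiableAt_gradSpeed (hφ : ContMDiffAt (𝓡 4) 𝓘(ℝ, ℝ) 2 φ p) (hX : 0 < g.kin φ p) :
    MDifferentiableAt (𝓡 4) 𝓘(ℝ, ℝ) (g.gradSpeed ε φ) p := by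
  have hspeed : DifferentiableAt ℝ (fun x : ℝ ↦ ε * √(2 * x)) (g.kin φ p) :=
    ((differentiableAt_id.const_mul 2).sqrt (by positivity)).const_mul ε
  exact hspeed.mdifferentiableAt.comp p (g.mdifferentiableAt_kin hφ)

lemma eventually_kin_pos (hφ : ContMDiffAt (𝓡 4) 𝓘(ℝ, ℝ) 2 φ p) (hX : 0 < g.kin φ p) :
    ∀ᶠ q in 𝓝 p, 0 < g.kin φ q :=
  (g.mdifferentiableAt_kin hφ).continuousAt.eventually_const_lt hX

lemma mdifferentiableAt_velocity (hφ : ContMDiffAt (𝓡 4) 𝓘(ℝ, ℝ) 2 φ p) (hX : 0 < g.kin φ p) :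
    MDifferentiableAt (𝓡 4) ((𝓡 4).prod 𝓘(ℝ, E4))
      (fun q ↦ TotalSpace.mk' E4 q (g.velocity ε φ q)) p := by
  have hscale : DifferentiableAt ℝ (fun x : ℝ ↦ ε / √(2 * x)) (g.kin φ p) :=
    (differentiableAt_const ε).div ((differentiableAt_id.const_mul 2).sqrt (by positivity))
      (Real.sqrt_pos.2 (by positivity)).ne'
  have hgrad := g.mdifferentiableAt_grad hφ
  rw [mdifferentiableAt_iff_vcomp] at hgrad ⊢
  refine ((hscale.mdifferentiableAt.comp p (g.mdifferentiableAt_kin hφ)).smul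
    hgrad).congr_of_eventuallyEq (.of_forall fun q ↦ ?_)
  simp [vcomp, velocity]

lemma grad_eq_gradSpeed_smul_velocity (hε : ε = 1 ∨ ε = -1) (hX : 0 < g.kin φ p) :
    g.grad φ p = g.gradSpeed ε φ p • g.velocity ε φ p := by
  have hsqrt : √(2 * g.kin φ p) ≠ 0 := (Real.sqrt_pos.2 (by positivity)).ne'
  have hscale : ε * √(2 * g.kin φ p) * (ε / √(2 * g.kin φ p)) = 1 := by
    field_simp
    exact sq_eq_one_iff.2 hε
  rw [velocity, gradSpeed, smul_smul, hscale, one_smul]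

lemma mvfderiv_eq_gradSpeed_mul (hε : ε = 1 ∨ ε = -1) (hX : 0 < g.kin φ p)
    (w : TangentSpace (𝓡 4) p) :
    mvfderiv (𝓡 4) φ p w = g.gradSpeed ε φ p * g.val p (g.velocity ε φ p) w := by
  rw [← g.val_grad, g.grad_eq_gradSpeed_smul_velocity hε hX, map_smul, smul_apply, smul_eq_mul]

lemma val_acceleration_velocity (hε : ε = 1 ∨ ε = -1) (hφ : ContMDiffAt (𝓡 4) 𝓘(ℝ, ℝ) 2 φ p)
    (hX : 0 < g.kin φ p) : g.val p (g.acceleration ε φ p) (g.velocity ε φ p) = 0 := by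
  have hu := g.mdifferentiableAt_velocity (ε := ε) hφ hX
  have hunit : (fun q ↦ g.val q (g.velocity ε φ q) (g.velocity ε φ q)) =ᶠ[𝓝 p] fun _ ↦ (-1 : ℝ) :=
    (g.eventually_kin_pos hφ hX).mono fun q hq ↦ g.velocity_unit hε hq
  have hmetric := g.leviCivita_metric hu hu (g.velocity ε φ p)
  rw [mvfderiv_congr hunit, mvfderiv_const, g.symm p (g.velocity ε φ p), zero_apply] at hmetric
  rw [acceleration]
  linarith

lemma leviCivita_grad (hε : ε = 1 ∨ ε = -1) (hφ : ContMDiffAt (𝓡 4) 𝓘(ℝ, ℝ) 2 φ p)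
    (hX : 0 < g.kin φ p) :
    g.leviCivita (g.grad φ) p = g.gradSpeed ε φ p • g.leviCivita (g.velocity ε φ) p +
      (mvfderiv (𝓡 4) (g.gradSpeed ε φ) p).smulRight (g.velocity ε φ p) :=
  g.leviCivita_smul_of_eventuallyEq
    ((g.eventually_kin_pos hφ hX).mono fun _ hq ↦ g.grad_eq_gradSpeed_smul_velocity hε hq)
    (g.mdifferentiableAt_gradSpeed hφ hX) (g.mdifferentiableAt_velocity hφ hX)

lemma box_eq_gradSpeed_mul_expansion_add (hε : ε = 1 ∨ ε = -1)
    (hφ : ContMDiffAt (𝓡 4) 𝓘(ℝ, ℝ) 2 φ p) (hX : 0 < g.kin φ p) :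
    g.box φ p = g.gradSpeed ε φ p * g.expansion ε φ p +
      mvfderiv (𝓡 4) (g.gradSpeed ε φ) p (g.velocity ε φ p) := by
  have : FiniteDimensional ℝ (TangentSpace (𝓡 4) p) := inferInstanceAs (FiniteDimensional ℝ E4)
  rw [box, divergence, g.leviCivita_grad hε hφ hX, expansion, divergence,
    ContinuousLinearMap.toLinearMap_add, ContinuousLinearMap.toLinearMap_smul, map_add, map_smul,
    smul_eq_mul]
  exact congrArg _ (LinearMap.trace_smulRight _ _)

lemma mvfderiv_gradSpeed_velocity (hε : ε = 1 ∨ ε = -1)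
    (hφ : ContMDiffAt (𝓡 4) 𝓘(ℝ, ℝ) 2 φ p) (hX : 0 < g.kin φ p) :
    mvfderiv (𝓡 4) (g.gradSpeed ε φ) p (g.velocity ε φ p) =
      -g.expansion ε φ p * g.gradSpeed ε φ p + g.box φ p := by
  rw [g.box_eq_gradSpeed_mul_expansion_add hε hφ hX]
  ring

lemma hess_velocity_of_orthogonal (hε : ε = 1 ∨ ε = -1) (hφ : ContMDiffAt (𝓡 4) 𝓘(ℝ, ℝ) 2 φ p)
    (hX : 0 < g.kin φ p) {w : TangentSpace (𝓡 4) p} (hw : g.val p (g.velocity ε φ p) w = 0) :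
    g.hess φ p (g.velocity ε φ p) w = g.gradSpeed ε φ p * g.val p (g.acceleration ε φ p) w := by
  rw [hess, g.leviCivita_grad hε hφ hX, acceleration]
  simp [hw]

lemma mvfderiv_kin_of_orthogonal (hε : ε = 1 ∨ ε = -1) (hφ : ContMDiffAt (𝓡 4) 𝓘(ℝ, ℝ) 2 φ p)
    (hX : 0 < g.kin φ p) {w : TangentSpace (𝓡 4) p} (hw : g.val p (g.velocity ε φ p) w = 0) :
    mvfderiv (𝓡 4) (g.kin φ) p w = -(2 * g.kin φ p) * g.val p (g.acceleration ε φ p) w := by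
  have hgrad : g.hess φ p (g.grad φ p) w =
      g.gradSpeed ε φ p * g.hess φ p (g.velocity ε φ p) w := by
    rw [hess, hess, g.grad_eq_gradSpeed_smul_velocity hε hX, map_smul, map_smul, smul_apply,
      smul_eq_mul]
  rw [g.mvfderiv_kin hφ, g.hess_symm hφ, hgrad, g.hess_velocity_of_orthogonal hε hφ hX hw,
    ← g.gradSpeed_sq hε hX]
  ring

end Velocity

end LorentzMetric

namespace ViableHorndeski

variable (S : ViableHorndeski) (g : LorentzMetric M) {f : ℝ → ℝ → ℝ} {ε : ℝ} {φ : M → ℝ} {p : M}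

lemma fieldTensor_velocity_of_orthogonal (hε : ε = 1 ∨ ε = -1)
    (hφ : ContMDiffAt (𝓡 4) 𝓘(ℝ, ℝ) 2 φ p) (hX : 0 < g.kin φ p)
    (hG4 : ContDiffAt ℝ 2 S.G4 (φ p))
    (hG3 : DifferentiableAt ℝ (fun z : ℝ × ℝ ↦ S.G3 z.1 z.2) (φ p, g.kin φ p))
    {w : TangentSpace (𝓡 4) p} (hw : g.val p (g.velocity ε φ p) w = 0) :
    S.fieldTensor g φ p (g.velocity ε φ p) w =
      S.G4 (φ p) * g.einstein p (g.velocity ε φ p) w -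
        (deriv S.G4 (φ p) - g.kin φ p * deriv (S.G3 (φ p)) (g.kin φ p)) *
          (g.gradSpeed ε φ p * g.val p (g.acceleration ε φ p) w) := by
  have hdφu : mvfderiv (𝓡 4) φ p (g.velocity ε φ p) = -g.gradSpeed ε φ p := by
    rw [g.mvfderiv_eq_gradSpeed_mul hε hX, g.velocity_unit hε hX, mul_neg_one]
  have hdφw : mvfderiv (𝓡 4) φ p w = 0 := by
    rw [g.mvfderiv_eq_gradSpeed_mul hε hX, hw, mul_zero]
  have hdG3w : mvfderiv (𝓡 4) (fun q ↦ S.G3 (φ q) (g.kin φ q)) p w =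
      -deriv (S.G3 (φ p)) (g.kin φ p) * (2 * g.kin φ p) * g.val p (g.acceleration ε φ p) w := by
    rw [mvfderiv_comp₂_eq_deriv_smul_add hG3 (hφ.mdifferentiableAt two_ne_zero)
      (g.mdifferentiableAt_kin hφ), add_apply, smul_apply, smul_apply, hdφw,
      g.mvfderiv_kin_of_orthogonal hε hφ hX hw]
    simp only [smul_eq_mul]
    ring
  simp only [fieldTensor, g.hess_comp hG4 hφ, g.hess_velocity_of_orthogonal hε hφ hX hw,
    hw, hdφu, hdφw, hdG3w]
  ring

lemma heatFlux_eq_neg_gravTemp_mul (hε : ε = 1 ∨ ε = -1) (hφ : ContMDiffAt (𝓡 4) 𝓘(ℝ, ℝ) 2 φ p)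
    (hX : 0 < g.kin φ p) (hG4 : ContDiffAt ℝ 2 S.G4 (φ p)) (hG4_ne : S.G4 (φ p) ≠ 0)
    (hG3 : DifferentiableAt ℝ (fun z : ℝ × ℝ ↦ S.G3 z.1 z.2) (φ p, g.kin φ p))
    (w : TangentSpace (𝓡 4) p) :
    S.heatFlux g φ f ε p w = -S.gravTemp g φ f ε p * g.val p (g.acceleration ε φ p) w := by
  have horth : g.val p (g.velocity ε φ p) (w + g.val p (g.velocity ε φ p) w • g.velocity ε φ p)
      = 0 := by
    rw [map_add, map_smul, g.velocity_unit hε hX, smul_eq_mul, mul_neg_one, add_neg_cancel]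
  have hacc : g.val p (g.acceleration ε φ p)
      (w + g.val p (g.velocity ε φ p) w • g.velocity ε φ p) =
      g.val p (g.acceleration ε φ p) w := by
    rw [map_add, map_smul, g.val_acceleration_velocity hε hφ hX, smul_zero, add_zero]
  simp only [heatFlux, effectiveStress, gravTemp,
    S.fieldTensor_velocity_of_orthogonal g hε hφ hX hG4 hG3 horth, hacc, LorentzMetric.gradSpeed]
  field_simp
  ring

lemma gravTemp_eq_gradSpeed (hf : f (φ p) (g.kin φ p) =
      (deriv S.G4 (φ p) - g.kin φ p * deriv (S.G3 (φ p)) (g.kin φ p)) / S.G4 (φ p))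
    (hf_ne : f (φ p) (g.kin φ p) ≠ 0) :
    S.gravTemp g φ f ε p = g.gradSpeed ε φ p := by
  rw [gravTemp, mul_div_assoc, ← hf, LorentzMetric.gradSpeed]
  field_simp

end ViableHorndeski

end ScalarTensor

theorem theorem2_general {M : Type*} [TopologicalSpace M] [ChartedSpace ScalarTensor.E4 M]
    [IsManifold (𝓡 4) ∞ M] (g : ScalarTensor.LorentzMetric M) (S : ScalarTensor.ViableHorndeski)
    (φ : M → ℝ) (hφ : ContMDiff (𝓡 4) 𝓘(ℝ, ℝ) 2 φ) (htimelike : ∀ p, 0 < g.kin φ p)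
    (hG4 : ∀ p, ContDiffAt ℝ 2 S.G4 (φ p))
    (hG3 : ∀ p, DifferentiableAt ℝ (fun z : ℝ × ℝ ↦ S.G3 z.1 z.2) (φ p, g.kin φ p))
    (f : ℝ → ℝ → ℝ) (hf : ∀ p, f (φ p) (g.kin φ p) =
      (deriv S.G4 (φ p) - g.kin φ p * deriv (S.G3 (φ p)) (g.kin φ p)) / S.G4 (φ p))
    (hf_ne : ∀ p, f (φ p) (g.kin φ p) ≠ 0) (ε : ℝ) (hε : ε = 1 ∨ ε = -1) :
    let u := g.velocity ε φ
    let KT := S.gravTemp g φ f ε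
    (∀ p, KT p = ε * √(2 * g.kin φ p)) ∧
    (∀ p (w : TangentSpace (𝓡 4) p),
      S.heatFlux g φ f ε p w = -KT p * g.val p (g.acceleration ε φ p) w) ∧
    (∀ p, mvfderiv (𝓡 4) KT p (u p) = -g.expansion ε φ p * KT p + g.box φ p) ∧
    (∀ (γ : ℝ → M) (τ : ℝ), IsMIntegralCurveAt γ u τ →
      HasDerivAt (fun t ↦ KT (γ t)) (-g.expansion ε φ (γ τ) * KT (γ τ) + g.box φ (γ τ)) τ) := by
  intro u KT
  have hKT : KT = g.gradSpeed ε φ := funext fun p ↦ S.gravTemp_eq_gradSpeed g (hf p) (hf_ne p)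
  have hG4_ne (p : M) : S.G4 (φ p) ≠ 0 := fun h ↦ hf_ne p (by rw [hf, h, div_zero])
  have hevol (p : M) : mvfderiv (𝓡 4) KT p (u p) = -g.expansion ε φ p * KT p + g.box φ p := by
    rw [hKT]
    exact g.mvfderiv_gradSpeed_velocity hε (hφ p) (htimelike p)
  refine ⟨fun p ↦ congrFun hKT p,
    fun p ↦ S.heatFlux_eq_neg_gravTemp_mul g hε (hφ p) (htimelike p) (hG4 p) (hG4_ne p) (hG3 p),
    hevol, fun γ τ hγ ↦ ?_⟩
  rw [← hevol]
  exact ScalarTensor.hasDerivAt_comp_of_isMIntegralCurveAt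
    (hKT ▸ g.mdifferentiableAt_gradSpeed (hφ (γ τ)) (htimelike (γ τ))) hγ

theorem theorem2 {M : Type*} [TopologicalSpace M] [ChartedSpace ScalarTensor.E4 M]
    [IsManifold (𝓡 4) ∞ M]
    -- the spacetime metric
    (g : ScalarTensor.LorentzMetric M)
    -- the functions of the theory, and the positive scalar field with timelike gradient
    (Omega V : ℝ → ℝ) (φ : M → ℝ) (hφ : ContMDiff (𝓡 4) 𝓘(ℝ, ℝ) ∞ φ)
    (hpos : ∀ p, 0 < φ p) (htimelike : ∀ p, 0 < g.kin φ p)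
    -- the sign in the four-velocity
    (ε : ℝ) (hε : ε = 1 ∨ ε = -1) :
    let S := ScalarTensor.ViableHorndeski.traditional Omega V
    let f : ℝ → ℝ → ℝ := fun s _ ↦ 1 / s
    let u := g.velocity ε φ
    let KT := S.gravTemp g φ f ε
    -- the temperature of gravity
    (∀ p, KT p = ε * √(2 * g.kin φ p)) ∧
    -- it is the coefficient in Eckart's generalized Fourier law
    (∀ p (w : TangentSpace (𝓡 4) p),
      S.heatFlux g φ f ε p w = -KT p * g.val p (g.acceleration ε φ p) w) ∧
    -- evolution equation, as a derivative along the four-velocity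
    (∀ p, mvfderiv (𝓡 4) KT p (u p) = -g.expansion ε φ p * KT p + g.box φ p) ∧
    -- evolution equation, in the proper time of a comoving observer
    (∀ (γ : ℝ → M) (τ : ℝ), IsMIntegralCurveAt γ u τ →
      HasDerivAt (fun t ↦ KT (γ t)) (-g.expansion ε φ (γ τ) * KT (γ τ) + g.box φ (γ τ)) τ) := by
  exact theorem2_general g (.traditional Omega V) φ (hφ.of_le (by norm_cast)) htimelike
    (fun _ ↦ contDiffAt_id) (fun _ ↦ differentiableAt_const 0) _
    (fun p ↦ by simp [ScalarTensor.ViableHorndeski.traditional])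
    (fun p ↦ one_div_ne_zero (hpos p).ne') ε hε
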